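/- Let $B=\{(x,y)\in\mathbb{R}^2: x^2+y^2\le 1\}$. For a function $f$ on $B$ let $$\mathcal{R}f(\theta,t)=\int_{I(\theta,t)} f\,d\ell,\qquad I(\theta,t)=\{(x,y): x\cos\theta+y\sin\theta=t\}\cap B,$$ be its Radon transform, where $d\ell$ denotes arc length. Let $N_d, N$ be positive integers with $N_d\le N$, and put $\phi_\nu=\frac{2\nu\pi}{N}$ and $\psi_j=\frac{(2j+1)\pi}{2N_d}$. The discrete sine coefficients of the Radon data of $f$ are $$\lambda_{k,\nu}=\frac{1}{N_d}\sum_{j=0}^{N_d-1}\sin\big((k+1)\psi_j\big)\,\mathcal{R}f(\phi_\nu,\cos\psi_j).$$ Let $U_k$ be the Chebyshev polynomial of the second kind, $U_k(\cos\theta)=\frac{\sin (k+1)\theta}{\sin\theta}$. Let $0<\tau<1$, and let $\eta$ be a real-valued function with $\eta(t)=1$ for $t\in[0,\tau]$ (for example a smooth cut-off function; no other property of $\eta$ is required). **Proposition.** Let $f$ be a real polynomial in two variables of total degree at most $\tau N_d$; if $N$ is even, assume in addition that the degree of $f$ is less than $N/2$ (which holds automatically when $N_d\le N/2$). Then $$\lambda_{k,\mu}=\eta\Big(\frac{k}{N_d}\Big)\,\frac1N\sum_{\nu=0}^{N-1}\lambda_{k,\nu}\,U_k\big(\cos(\phi_\mu-\phi_\nu)\big)$$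 for all $0\le k\le N_d-1$ and $0\le\mu\le N-1$. -/

import Mathlib

noncomputable section

namespace OPED

/-- The closed unit disk `B` in the plane. -/
def unitDisk : Set (ℝ × ℝ) := {p | p.1 ^ 2 + p.2 ^ 2 ≤ 1}

/-- The point of the line `x cos θ + y sin θ = t` at signed arc length `s` from the foot
`(t cos θ, t sin θ)` of the perpendicular from the origin. For fixed `θ` and `t`, the map
`s ↦ linePoint θ t s` is a bijective arc length parametrization of that line. -/
def linePoint (θ t s : ℝ) : ℝ × ℝ :=
  (t * Real.cos θ - s * Real.sin θ, t * Real.sin θ + s * Real.cos θ)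

/-- The Radon transform of a function on the disk: the integral of `f` with respect to arc length
over the segment `I(θ, t) = {(x, y) : x cos θ + y sin θ = t} ∩ B`. -/
def radon (f : ℝ × ℝ → ℝ) (θ t : ℝ) : ℝ :=
  ∫ s in {s : ℝ | linePoint θ t s ∈ unitDisk}, f (linePoint θ t s)

/-- The view angles `φ_ν = 2νπ / N`. -/
def viewAngle (N ν : ℕ) : ℝ := 2 * (ν : ℝ) * Real.pi / (N : ℝ)

/-- The angles `ψ_j = (2j + 1)π / (2 N_d)` of the detector positions `cos ψ_j`. -/
def nodeAngle (Nd j : ℕ) : ℝ := (2 * (j : ℝ) + 1) * Real.pi / (2 * (Nd : ℝ))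

/-- The discrete sine coefficients
`λ_{k,ν} = (1 / N_d) ∑_{j=0}^{N_d - 1} sin ((k + 1) ψ_j) R f (φ_ν, cos ψ_j)`
of the Radon data of `f`. -/
def sineCoeff (f : ℝ × ℝ → ℝ) (N Nd k ν : ℕ) : ℝ :=
  (1 / (Nd : ℝ)) * ∑ j ∈ Finset.range Nd,
    Real.sin (((k : ℝ) + 1) * nodeAngle Nd j) *
      radon f (viewAngle N ν) (Real.cos (nodeAngle Nd j))

/-- The function on the plane given by a real polynomial in two variables. -/
def polyFun (P : MvPolynomial (Fin 2) ℝ) : ℝ × ℝ → ℝ :=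
  fun p => MvPolynomial.eval ![p.1, p.2] P

end OPED

end

/-! Both sides are linear in `P`, and ridge polynomials `U_m(x cos α + y sin α)`, `m ≤ n`, span all
polynomials of degree at most `n` (`linearMap_eq_zero_of_ridge`), so ridges suffice. Their Radon
data separate: `radon_ridge` gives `2/(m+1) · sin((m+1)ψ) · U_m(cos(θ - α))`. Discrete orthogonality
of sines at the nodes (`sum_sin_mul_sin_nodeAngle`) leaves only `m = k`, and there
`chebyshev_U_discrete_convolution` reproduces `U_k`. The cut-off is harmless: if `k` exceeds the
degree, all coefficients vanish; otherwise `k / Nd ≤ τ` and `η = 1`. -/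

open Polynomial in
/-- A linear functional on bivariate polynomials that annihilates all Chebyshev ridge polynomials
of degree at most `n` annihilates all polynomials of degree at most `n`. -/
theorem linearMap_eq_zero_of_ridge (n : ℕ) (L : MvPolynomial (Fin 2) ℝ →ₗ[ℝ] ℝ)
    (h : ∀ m ≤ n, ∀ α : ℝ, L (aeval (MvPolynomial.C (Real.cos α) * MvPolynomial.X 0 +
      MvPolynomial.C (Real.sin α) * MvPolynomial.X 1) (Chebyshev.U ℝ (m : ℤ))) = 0)
    (P : MvPolynomial (Fin 2) ℝ) (hP : P.totalDegree ≤ n) : L P = 0 := by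
  -- powers of unit linear forms
  have hpow : ∀ m ≤ n, ∀ α : ℝ, L ((MvPolynomial.C (Real.cos α) * MvPolynomial.X 0 +
      MvPolynomial.C (Real.sin α) * MvPolynomial.X 1) ^ m) = 0 := by
    intro m hm α
    let S : Polynomial.Sequence ℝ :=
      ⟨fun i => Chebyshev.U ℝ (i : ℤ), fun i => Chebyshev.degree_U_natCast ℝ i⟩
    let M : ℝ[X] →ₗ[ℝ] ℝ := L ∘ₗ (aeval (MvPolynomial.C (Real.cos α) * MvPolynomial.X 0 +
      MvPolynomial.C (Real.sin α) * MvPolynomial.X 1 : MvPolynomial (Fin 2) ℝ)).toLinearMap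
    -- The `U_i` have degree exactly `i`, so `U_0, …, U_n` span the univariate polynomials of degree
    -- at most `n`.
    have hle : degreeLE ℝ n ≤ LinearMap.ker M := by
      rw [← S.span_degreeLE (m := n) fun i _ => (leadingCoeff_ne_zero.2 (S.ne_zero i)).isUnit,
        Submodule.span_le]
      rintro _ ⟨i, hi, rfl⟩
      exact h i hi α
    have hX : (X ^ m : ℝ[X]) ∈ degreeLE ℝ n := by
      rw [mem_degreeLE, degree_X_pow]
      exact_mod_cast hm
    simpa [M] using hle hX
  -- powers of arbitrary linear forms
  have hpow' : ∀ m ≤ n, ∀ s : ℝ,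
      L ((MvPolynomial.C s * MvPolynomial.X 1 + MvPolynomial.X 0) ^ m) = 0 := by
    intro m hm s
    have hc : Real.cos (Real.arctan s) ≠ 0 := (Real.cos_arctan_pos s).ne'
    have hs : Real.sin (Real.arctan s) = Real.cos (Real.arctan s) * s := by
      rw [Real.sin_arctan, Real.cos_arctan]; ring
    have := hpow m hm (Real.arctan s)
    rw [hs, MvPolynomial.C_mul, mul_assoc, ← mul_add, mul_pow, ← MvPolynomial.C_pow,
      MvPolynomial.C_mul', map_smul, smul_eq_mul, add_comm] at this
    exact (mul_eq_zero.1 this).resolve_left (pow_ne_zero _ hc)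
  have hmon : ∀ a b : ℕ, a + b ≤ n →
      L (MvPolynomial.X 0 ^ a * MvPolynomial.X 1 ^ b) = 0 := by
    intro a b hab
    -- As a polynomial in `s`, this is `L ((s y + x)^(a+b))`. It vanishes for every `s`, hence
    -- coefficientwise; coefficient `b` isolates `x^a y^b`.
    let p : ℝ[X] := ∑ j ∈ Finset.range (a + b + 1), monomial j
      (L (MvPolynomial.X 1 ^ j * MvPolynomial.X 0 ^ (a + b - j)) * (a + b).choose j)
    have hp : p = 0 := by
      refine Polynomial.funext fun s => ?_
      rw [eval_zero, ← hpow' (a + b) hab s, add_pow, map_sum, eval_finsetSum]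
      refine Finset.sum_congr rfl fun j _ => ?_
      have : (MvPolynomial.C s * MvPolynomial.X 1) ^ j * MvPolynomial.X 0 ^ (a + b - j) *
          (((a + b).choose j : ℕ) : MvPolynomial (Fin 2) ℝ) =
          (s ^ j * (a + b).choose j) •
            (MvPolynomial.X 1 ^ j * MvPolynomial.X 0 ^ (a + b - j)) := by
        rw [MvPolynomial.smul_eq_C_mul, MvPolynomial.C_mul, MvPolynomial.C_pow, map_natCast]
        ring
      rw [this, map_smul, eval_monomial, smul_eq_mul]
      ring
    have hcoeff : p.coeff b = 0 := by rw [hp, coeff_zero]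
    simp only [p, finsetSum_coeff, coeff_monomial] at hcoeff
    rw [Finset.sum_ite_eq' , if_pos (by simp), Nat.add_sub_cancel, mul_comm (_ ^ b)] at hcoeff
    refine (mul_eq_zero.1 hcoeff).resolve_right ?_
    exact_mod_cast (Nat.choose_pos (Nat.le_add_left b a)).ne'
  rw [P.as_sum, map_sum]
  refine Finset.sum_eq_zero fun v hv => ?_
  have hd := (MvPolynomial.le_totalDegree hv).trans hP
  rw [Finsupp.sum_fintype _ _ fun _ => rfl, Fin.sum_univ_two] at hd
  rw [MvPolynomial.monomial_eq, Finsupp.prod_fintype _ _ fun _ => pow_zero _, Fin.prod_univ_two,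
    MvPolynomial.C_mul', map_smul, hmon _ _ hd, smul_zero]

/-! ### Chebyshev polynomials on equispaced angles -/

/-- `U_{m+2} = 2 T_{m+2} + U_m` adds just the extreme frequencies `±(m+2)`. -/
theorem chebyshev_U_eval_cos_eq_sum_exp (m : ℕ) (x : ℝ) :
    (((Polynomial.Chebyshev.U ℝ (m : ℤ)).eval (Real.cos x) : ℝ) : ℂ) =
      ∑ l ∈ Finset.range (m + 1), Complex.exp (((m : ℂ) - 2 * l) * x * Complex.I) := by
  induction m using Nat.twoStepInduction with
  | zero => simp
  | one =>
    simp only [Nat.cast_one, Polynomial.Chebyshev.U_one, Finset.sum_range_succ]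
    simp [Complex.cos]
    ring_nf
  | more m ih _ =>
    rw [Nat.cast_add m 2, Nat.cast_two, Polynomial.Chebyshev.U_eq_two_mul_T_add_U,
      Polynomial.eval_add, Polynomial.eval_mul, Polynomial.Chebyshev.T_real_cos,
      Complex.ofReal_add, ih, Finset.sum_range_succ _ (m + 2), Finset.sum_range_succ' _ (m + 1)]
    push_cast
    simp only [Complex.cos, Polynomial.eval_ofNat]
    have e : ∀ l : ℕ, ((m : ℂ) + 2 - 2 * (l + 1)) = m - 2 * l := fun l => by ring
    simp only [e]
    push_cast
    ring_nf

theorem sum_exp_eq_zero (N : ℕ) (d : ℤ) (hd : ¬ (N : ℤ) ∣ d) :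
    ∑ ν ∈ Finset.range N, Complex.exp (d * (2 * ν * Real.pi / N : ℝ) * Complex.I) = 0 := by
  rcases Nat.eq_zero_or_pos N with rfl | hN
  · simp
  have hN' : (N : ℂ) ≠ 0 := by exact_mod_cast hN.ne'
  have hpi : (Real.pi : ℂ) ≠ 0 := by exact_mod_cast Real.pi_ne_zero
  set ω : ℂ := Complex.exp (d * (2 * Real.pi * Complex.I) / N) with hω
  have h1 : ω ≠ 1 := by
    intro h
    obtain ⟨q, hq⟩ := Complex.exp_eq_one_iff.1 h
    refine hd ⟨q, ?_⟩
    field_simp at hq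
    exact_mod_cast hq
  have hN1 : ω ^ N = 1 := by
    rw [hω, ← Complex.exp_nat_mul, mul_div_cancel₀ _ hN', Complex.exp_int_mul_two_pi_mul_I]
  have : ∀ ν ∈ Finset.range N,
      Complex.exp (d * (2 * ν * Real.pi / N : ℝ) * Complex.I) = ω ^ ν := by
    intro ν _
    rw [hω, ← Complex.exp_nat_mul]
    push_cast
    ring_nf
  rw [Finset.sum_congr rfl this, geom_sum_eq h1, hN1, sub_self, zero_div]

/-- Chebyshev polynomials of the second kind reproduce themselves under convolution over
`N` equispaced angles, provided that the product of frequencies is not aliased. -/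
theorem chebyshev_U_discrete_convolution (N m : ℕ) (hm : m < N) (heven : Even N → 2 * m < N)
    (β α : ℝ) :
    ∑ ν ∈ Finset.range N,
      (Polynomial.Chebyshev.U ℝ (m : ℤ)).eval (Real.cos (2 * ν * Real.pi / N - α)) *
        (Polynomial.Chebyshev.U ℝ (m : ℤ)).eval (Real.cos (β - 2 * ν * Real.pi / N)) =
      N * (Polynomial.Chebyshev.U ℝ (m : ℤ)).eval (Real.cos (β - α)) := by
  rw [← Complex.ofReal_inj, Complex.ofReal_sum, Complex.ofReal_mul,
    chebyshev_U_eval_cos_eq_sum_exp]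
  simp only [Complex.ofReal_mul, chebyshev_U_eval_cos_eq_sum_exp, Finset.sum_mul_sum]
  rw [Finset.sum_comm, Finset.mul_sum]
  refine Finset.sum_congr rfl fun l hl => ?_
  rw [Finset.sum_comm, Finset.sum_eq_single l]
  · rw [Finset.sum_congr rfl (g := fun _ =>
      Complex.exp (((m : ℂ) - 2 * l) * (β - α : ℝ) * Complex.I)), Finset.sum_const,
      Finset.card_range, nsmul_eq_mul, Complex.ofReal_natCast]
    intro ν _
    rw [← Complex.exp_add]
    push_cast
    ring_nf
  · intro l' hl' hne
    rw [Finset.mem_range] at hl hl'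
    -- No aliasing: `0 < |l' - l| ≤ m`. For odd `N` the factor 2 cancels and `m < N` suffices; for
    -- even `N` the bound `2m < N` is used.
    have hd : ¬ (N : ℤ) ∣ 2 * ((l' : ℤ) - l) := by
      intro hdvd
      rcases Nat.even_or_odd N with hev | hodd
      · have := Int.eq_zero_of_abs_lt_dvd hdvd (by have := heven hev; rw [abs_lt]; omega)
        omega
      · have hcop : IsCoprime (N : ℤ) 2 := by
          exact_mod_cast Nat.isCoprime_iff_coprime.2 (Nat.coprime_two_right.2 hodd)
        have := Int.eq_zero_of_abs_lt_dvd (hcop.dvd_of_dvd_mul_left hdvd) (by rw [abs_lt]; omega)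
        omega
    have key := sum_exp_eq_zero N _ hd
    rw [← mul_zero (Complex.exp ((((m : ℂ) - 2 * l') * β - ((m : ℂ) - 2 * l) * α) * Complex.I)),
      ← key, Finset.mul_sum]
    refine Finset.sum_congr rfl fun ν _ => ?_
    rw [← Complex.exp_add, ← Complex.exp_add]
    push_cast
    ring_nf
  · intro h; exact absurd hl h

namespace OPED

/-! ### Radon transform of ridge polynomials -/

theorem linePoint_mem_unitDisk_iff (θ t s : ℝ) :
    linePoint θ t s ∈ unitDisk ↔ t ^ 2 + s ^ 2 ≤ 1 := by
  have h : (t * Real.cos θ - s * Real.sin θ) ^ 2 + (t * Real.sin θ + s * Real.cos θ) ^ 2 =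
      t ^ 2 + s ^ 2 := by
    linear_combination (t ^ 2 + s ^ 2) * Real.sin_sq_add_cos_sq θ
  simp only [unitDisk, linePoint, Set.mem_ofPred_eq, h]

theorem radon_cos (f : ℝ × ℝ → ℝ) (θ ψ : ℝ) (hψ : 0 ≤ Real.sin ψ) :
    radon f θ (Real.cos ψ) = ∫ s in (-Real.sin ψ)..(Real.sin ψ), f (linePoint θ (Real.cos ψ) s) := by
  have hset : {s : ℝ | linePoint θ (Real.cos ψ) s ∈ unitDisk} =
      Set.Icc (-Real.sin ψ) (Real.sin ψ) := by
    ext s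
    rw [Set.mem_ofPred_eq, linePoint_mem_unitDisk_iff, Set.mem_Icc, ← abs_le,
      ← sq_le_sq₀ (abs_nonneg s) hψ, sq_abs]
    constructor <;> intro h <;> linarith [Real.sin_sq_add_cos_sq ψ]
  rw [radon, hset, MeasureTheory.integral_Icc_eq_integral_Ioc,
    intervalIntegral.integral_of_le (by linarith)]

theorem continuous_polyFun_linePoint (P : MvPolynomial (Fin 2) ℝ) (θ t : ℝ) :
    Continuous fun s => polyFun P (linePoint θ t s) := by
  refine (MvPolynomial.continuous_eval P).comp (continuous_pi fun i => ?_)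
  fin_cases i <;> simp [linePoint] <;> fun_prop

/-- The chord integral of a Chebyshev ridge polynomial. -/
theorem integral_chebyshev_U_chord (m : ℕ) (δ ψ : ℝ) :
    ∫ s in (-Real.sin ψ)..(Real.sin ψ), (Polynomial.Chebyshev.U ℝ (m : ℤ)).eval
        (Real.cos ψ * Real.cos δ - s * Real.sin δ) =
      2 / ((m : ℝ) + 1) * Real.sin (((m : ℝ) + 1) * ψ) *
        (Polynomial.Chebyshev.U ℝ (m : ℤ)).eval (Real.cos δ) := by
  have hm : (m : ℝ) + 1 ≠ 0 := by positivity
  have hUψ := Polynomial.Chebyshev.U_real_cos ψ (m : ℤ)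
  have hUδ := Polynomial.Chebyshev.U_real_cos δ (m : ℤ)
  push_cast at hUψ hUδ
  -- The antiderivative `-T_{m+1} / ((m+1) sin δ)` needs `sin δ ≠ 0`; otherwise the integrand is
  -- constant and `cos δ = ±1`.
  by_cases hδ : Real.sin δ = 0
  · rw [hδ]
    simp only [mul_zero, sub_zero, intervalIntegral.integral_const, smul_eq_mul]
    rw [← hUψ]
    rcases Real.sin_eq_zero_iff_cos_eq.1 hδ with h | h
    · rw [h, mul_one, Polynomial.Chebyshev.U_eval_one]
      push_cast
      field_simp
      ring
    · rw [h, mul_neg_one, Polynomial.Chebyshev.U_eval_neg, Polynomial.Chebyshev.U_eval_neg_one]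
      push_cast
      field_simp
      ring
  · have hderiv : ∀ s : ℝ, HasDerivAt
        (fun s => -((Polynomial.Chebyshev.T ℝ ((m : ℤ) + 1)).eval
          (Real.cos ψ * Real.cos δ - s * Real.sin δ)) / (((m : ℝ) + 1) * Real.sin δ))
        ((Polynomial.Chebyshev.U ℝ (m : ℤ)).eval
          (Real.cos ψ * Real.cos δ - s * Real.sin δ)) s := by
      intro s
      have h1 : HasDerivAt (fun s : ℝ => Real.cos ψ * Real.cos δ - s * Real.sin δ)
          (-Real.sin δ) s := by
        simpa using ((hasDerivAt_id s).mul_const (Real.sin δ)).const_sub (Real.cos ψ * Real.cos δ)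
      have h2 := ((((Polynomial.Chebyshev.T ℝ ((m : ℤ) + 1)).hasDerivAt
        (Real.cos ψ * Real.cos δ - s * Real.sin δ)).comp s h1).neg).div_const
          (((m : ℝ) + 1) * Real.sin δ)
      refine h2.congr_deriv ?_
      rw [Polynomial.Chebyshev.T_derivative_eq_U, Polynomial.eval_mul, add_sub_cancel_right]
      simp only [Polynomial.eval_intCast]
      push_cast
      field_simp
    rw [intervalIntegral.integral_eq_sub_of_hasDerivAt (fun s _ => hderiv s)
      (Continuous.intervalIntegrable (by fun_prop) _ _)]
    have e1 : Real.cos ψ * Real.cos δ - Real.sin ψ * Real.sin δ = Real.cos (ψ + δ) :=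
      (Real.cos_add _ _).symm
    have e2 : Real.cos ψ * Real.cos δ - -Real.sin ψ * Real.sin δ = Real.cos (ψ - δ) := by
      rw [Real.cos_sub]; ring
    rw [e1, e2, Polynomial.Chebyshev.T_real_cos, Polynomial.Chebyshev.T_real_cos]
    push_cast
    rw [mul_add _ ψ δ, mul_sub _ ψ δ, Real.cos_add (_ * ψ), Real.cos_sub (_ * ψ), ← hUδ]
    field_simp
    ring

/-- The Chebyshev ridge polynomial `U_m (x cos α + y sin α)`. -/
noncomputable def ridge (m : ℕ) (α : ℝ) : MvPolynomial (Fin 2) ℝ :=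
  Polynomial.aeval (MvPolynomial.C (Real.cos α) * MvPolynomial.X 0 +
    MvPolynomial.C (Real.sin α) * MvPolynomial.X 1) (Polynomial.Chebyshev.U ℝ (m : ℤ))

theorem polyFun_ridge (m : ℕ) (α θ t s : ℝ) :
    polyFun (ridge m α) (linePoint θ t s) = (Polynomial.Chebyshev.U ℝ (m : ℤ)).eval
      (t * Real.cos (θ - α) - s * Real.sin (θ - α)) := by
  have h := Polynomial.aeval_algHom_apply
    (MvPolynomial.aeval ![(linePoint θ t s).1, (linePoint θ t s).2])
    (MvPolynomial.C (Real.cos α) * MvPolynomial.X 0 +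
      MvPolynomial.C (Real.sin α) * MvPolynomial.X 1) (Polynomial.Chebyshev.U ℝ (m : ℤ))
  rw [MvPolynomial.aeval_eq_eval] at h
  rw [polyFun, ridge]
  refine h.symm.trans ?_
  rw [Polynomial.coe_aeval_eq_eval]
  congr 1
  simp [linePoint, Real.cos_sub, Real.sin_sub]
  ring

theorem radon_ridge (m : ℕ) (α θ ψ : ℝ) (hψ : 0 ≤ Real.sin ψ) :
    radon (polyFun (ridge m α)) θ (Real.cos ψ) =
      2 / ((m : ℝ) + 1) * Real.sin (((m : ℝ) + 1) * ψ) *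
        (Polynomial.Chebyshev.U ℝ (m : ℤ)).eval (Real.cos (θ - α)) := by
  rw [radon_cos _ _ _ hψ, ← integral_chebyshev_U_chord]
  simp only [polyFun_ridge]

/-! ### Discrete sine orthogonality at the detector nodes -/

theorem sin_nodeAngle_nonneg (Nd j : ℕ) (hj : j < Nd) : 0 ≤ Real.sin (nodeAngle Nd j) := by
  have hNd : (0 : ℝ) < Nd := by exact_mod_cast (Nat.zero_le j).trans_lt hj
  have hj' : (j : ℝ) + 1 ≤ Nd := by exact_mod_cast hj
  refine Real.sin_nonneg_of_nonneg_of_le_pi ?_ ?_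
  · unfold nodeAngle; have := Real.pi_pos; positivity
  · rw [nodeAngle, div_le_iff₀ (by positivity)]
    nlinarith [Real.pi_pos]

/-- Multiplying by `2 sin(cπ/(2Nd))`, nonzero by `hc`, makes the sum telescope to `sin(cπ) - sin 0 =
0`. -/
theorem sum_cos_nodeAngle (Nd : ℕ) (c : ℤ) (hc : ¬ (2 * Nd : ℤ) ∣ c) :
    ∑ j ∈ Finset.range Nd, Real.cos (c * nodeAngle Nd j) = 0 := by
  rcases Nat.eq_zero_or_pos Nd with rfl | hNd
  · simp
  have hNd' : (Nd : ℝ) ≠ 0 := by exact_mod_cast hNd.ne'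
  have hs : Real.sin (c * Real.pi / (2 * Nd)) ≠ 0 := by
    intro h
    obtain ⟨q, hq⟩ := Real.sin_eq_zero_iff.1 h
    refine hc ⟨q, ?_⟩
    have hpi := Real.pi_ne_zero
    field_simp at hq
    have : (c : ℝ) = 2 * Nd * q := by linarith
    exact_mod_cast this
  refine (mul_eq_zero.1 (?_ : (2 * Real.sin (c * Real.pi / (2 * Nd))) * _ = 0)).resolve_left
    (mul_ne_zero two_ne_zero hs)
  have hstep : ∀ j : ℕ, 2 * Real.sin (c * Real.pi / (2 * Nd)) * Real.cos (c * nodeAngle Nd j) =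
      Real.sin (c * ((j + 1 : ℕ) : ℝ) * Real.pi / Nd) - Real.sin (c * (j : ℝ) * Real.pi / Nd) := by
    intro j
    have e1 : c * ((j + 1 : ℕ) : ℝ) * Real.pi / Nd =
        c * nodeAngle Nd j + c * Real.pi / (2 * Nd) := by
      rw [nodeAngle]; push_cast; field_simp; ring
    have e2 : c * (j : ℝ) * Real.pi / Nd =
        c * nodeAngle Nd j - c * Real.pi / (2 * Nd) := by
      rw [nodeAngle]; field_simp; ring
    rw [e1, e2, Real.sin_add, Real.sin_sub]
    ring
  rw [Finset.mul_sum, Finset.sum_congr rfl fun j _ => hstep j,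
    Finset.sum_range_sub fun j : ℕ => Real.sin (c * (j : ℝ) * Real.pi / Nd)]
  have : (c : ℝ) * Nd * Real.pi / Nd = c * Real.pi := by field_simp
  rw [this, Real.sin_int_mul_pi]
  simp

theorem sum_sin_mul_sin_nodeAngle (Nd k m : ℕ) (hk : k < Nd) (hm : m < Nd) (hkm : k ≠ m) :
    ∑ j ∈ Finset.range Nd, Real.sin (((k : ℝ) + 1) * nodeAngle Nd j) *
      Real.sin (((m : ℝ) + 1) * nodeAngle Nd j) = 0 := by
  have h1 := sum_cos_nodeAngle Nd ((k : ℤ) - m) fun h => by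
    have := Int.eq_zero_of_abs_lt_dvd h (by rw [abs_lt]; omega)
    omega
  -- Since `k ≠ m` are both at most `Nd - 1`, the frequency `k + m + 2` stays strictly below `2 Nd`.
  have h2 := sum_cos_nodeAngle Nd ((k : ℤ) + m + 2) fun h => by
    have := Int.eq_zero_of_abs_lt_dvd h (by rw [abs_lt]; omega)
    omega
  have h3 := congrArg₂ (fun x y => (x - y) / 2) h1 h2
  simp only [← Finset.sum_sub_distrib, Finset.sum_div, sub_zero, zero_div] at h3
  rw [← h3]
  refine Finset.sum_congr rfl fun j _ => ?_
  have e1 : (((k : ℤ) - m : ℤ) : ℝ) * nodeAngle Nd j =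
    ((k : ℝ) + 1) * nodeAngle Nd j - ((m : ℝ) + 1) * nodeAngle Nd j := by push_cast; ring
  have e2 : (((k : ℤ) + m + 2 : ℤ) : ℝ) * nodeAngle Nd j =
    ((k : ℝ) + 1) * nodeAngle Nd j + ((m : ℝ) + 1) * nodeAngle Nd j := by push_cast; ring
  rw [e1, e2, Real.cos_sub, Real.cos_add]
  ring

theorem sineCoeff_ridge (N Nd k ν m : ℕ) (α : ℝ) :
    sineCoeff (polyFun (ridge m α)) N Nd k ν =
      2 / ((m : ℝ) + 1) / Nd * (∑ j ∈ Finset.range Nd,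
        Real.sin (((k : ℝ) + 1) * nodeAngle Nd j) * Real.sin (((m : ℝ) + 1) * nodeAngle Nd j)) *
        (Polynomial.Chebyshev.U ℝ (m : ℤ)).eval (Real.cos (viewAngle N ν - α)) := by
  rw [sineCoeff, Finset.mul_sum, Finset.mul_sum, Finset.sum_mul]
  refine Finset.sum_congr rfl fun j hj => ?_
  rw [radon_ridge _ _ _ _ (sin_nodeAngle_nonneg Nd j (Finset.mem_range.1 hj))]
  ring

/-! ### From ridge polynomials to all polynomials -/

/-- The discrete sine coefficients as a linear functional on polynomials. -/
noncomputable def sineCoeffLinearMap (N Nd k ν : ℕ) : MvPolynomial (Fin 2) ℝ →ₗ[ℝ] ℝ where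
  toFun P := sineCoeff (polyFun P) N Nd k ν
  map_add' P Q := by
    rw [sineCoeff, sineCoeff, sineCoeff, ← mul_add, ← Finset.sum_add_distrib]
    congr 1
    refine Finset.sum_congr rfl fun j hj => ?_
    have hs := sin_nodeAngle_nonneg Nd j (Finset.mem_range.1 hj)
    rw [radon_cos _ _ _ hs, radon_cos _ _ _ hs, radon_cos _ _ _ hs, ← mul_add,
      ← intervalIntegral.integral_add
        ((continuous_polyFun_linePoint P _ _).intervalIntegrable _ _)
        ((continuous_polyFun_linePoint Q _ _).intervalIntegrable _ _)]
    simp only [polyFun, map_add]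
  map_smul' c P := by
    simp only [sineCoeff, radon, polyFun, MvPolynomial.smul_eval,
      MeasureTheory.integral_const_mul, RingHom.id_apply, smul_eq_mul, Finset.mul_sum]
    refine Finset.sum_congr rfl fun j _ => ?_
    ring

theorem sineCoeff_eq_zero_of_totalDegree_lt (N Nd k ν : ℕ) (hk : k < Nd)
    (P : MvPolynomial (Fin 2) ℝ) (hP : P.totalDegree < k) :
    sineCoeff (polyFun P) N Nd k ν = 0 := by
  refine linearMap_eq_zero_of_ridge P.totalDegree (sineCoeffLinearMap N Nd k ν)
    (fun m hm α => ?_) P le_rfl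
  change sineCoeff (polyFun (ridge m α)) N Nd k ν = 0
  rw [sineCoeff_ridge, sum_sin_mul_sin_nodeAngle Nd k m hk (by omega) (by omega)]
  simp

theorem sineCoeff_eq_discrete_convolution (N Nd n k μ : ℕ) (hnN : n < N) (hnd : n < Nd)
    (heven : Even N → 2 * n < N) (hk : k < Nd)
    (P : MvPolynomial (Fin 2) ℝ) (hP : P.totalDegree ≤ n) :
    sineCoeff (polyFun P) N Nd k μ = (1 / (N : ℝ)) *
      ∑ ν ∈ Finset.range N, sineCoeff (polyFun P) N Nd k ν *
        (Polynomial.Chebyshev.U ℝ (k : ℤ)).eval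
          (Real.cos (viewAngle N μ - viewAngle N ν)) := by
  -- The defect of the identity, as a linear functional to be tested on ridges only.
  let L : MvPolynomial (Fin 2) ℝ →ₗ[ℝ] ℝ := sineCoeffLinearMap N Nd k μ -
    (1 / (N : ℝ)) • ∑ ν ∈ Finset.range N, (Polynomial.Chebyshev.U ℝ (k : ℤ)).eval
      (Real.cos (viewAngle N μ - viewAngle N ν)) • sineCoeffLinearMap N Nd k ν
  have hL : ∀ Q, L Q = sineCoeff (polyFun Q) N Nd k μ - (1 / (N : ℝ)) *
      ∑ ν ∈ Finset.range N, sineCoeff (polyFun Q) N Nd k ν *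
        (Polynomial.Chebyshev.U ℝ (k : ℤ)).eval
          (Real.cos (viewAngle N μ - viewAngle N ν)) := by
    intro Q
    simp [L, sineCoeffLinearMap, LinearMap.sum_apply, mul_comm]
  refine sub_eq_zero.1 ((hL P).symm.trans ?_)
  refine linearMap_eq_zero_of_ridge n L (fun m hm α => ?_) P hP
  change L (ridge m α) = 0
  rw [hL]
  simp only [sineCoeff_ridge]
  by_cases hkm : k = m
  · subst hkm
    have hN : (N : ℝ) ≠ 0 := by exact_mod_cast (Nat.zero_le n).trans_lt hnN |>.ne'
    have h := chebyshev_U_discrete_convolution N k (by omega)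
      (fun h => by have := heven h; omega) (viewAngle N μ) α
    simp only [mul_assoc _ (Polynomial.eval _ _) (Polynomial.eval _ _), ← Finset.mul_sum]
    unfold viewAngle at h ⊢
    rw [h]
    field_simp
    ring
  · rw [sum_sin_mul_sin_nodeAngle Nd k m hk (by omega) hkm]
    simp

end OPED

theorem mainTheorem3 (N Nd : ℕ) (hNd : 0 < Nd) (hNdN : Nd ≤ N)
    (τ : ℝ) (hτ0 : 0 < τ) (hτ1 : τ < 1)
    (η : ℝ → ℝ) (hη : ∀ t ∈ Set.Icc (0 : ℝ) τ, η t = 1)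
    (P : MvPolynomial (Fin 2) ℝ)
    (hdeg : (P.totalDegree : ℝ) ≤ τ * (Nd : ℝ))
    (heven : Even N → 2 * P.totalDegree < N)
    (k μ : ℕ) (hk : k < Nd) (hμ : μ < N) :
    OPED.sineCoeff (OPED.polyFun P) N Nd k μ =
      η ((k : ℝ) / (Nd : ℝ)) * ((1 / (N : ℝ)) *
        ∑ ν ∈ Finset.range N, OPED.sineCoeff (OPED.polyFun P) N Nd k ν *
          (Polynomial.Chebyshev.U ℝ (k : ℤ)).eval
            (Real.cos (OPED.viewAngle N μ - OPED.viewAngle N ν))) := by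
  have hNd' : (0 : ℝ) < Nd := by exact_mod_cast hNd
  have hlt : P.totalDegree < Nd := by
    have : (P.totalDegree : ℝ) < Nd := by nlinarith
    exact_mod_cast this
  rcases lt_or_ge P.totalDegree k with h | h
  · simp [OPED.sineCoeff_eq_zero_of_totalDegree_lt N Nd k _ hk P h]
  · have hk' : (k : ℝ) ≤ P.totalDegree := by exact_mod_cast h
    rw [hη _ ⟨by positivity, (div_le_iff₀ hNd').2 (hk'.trans hdeg)⟩, one_mul]
    exact OPED.sineCoeff_eq_discrete_convolution N Nd P.totalDegree k μ (by omega) hlt heven hk P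
      le_rfl
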